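/- All graphs are finite and simple. For a graph $G$ and $T\subseteq V(G)$ let $c_G(T)$ be the number of connected components of $G\setminus T$. A cut vertex of $G$ is a vertex whose removal increases the number of connected components; a set $T\subseteq V(G)$ is a cutset of $G$ if every $t\in T$ is a cut vertex of $G\setminus (T\setminus\{t\})$, i.e. $c_G(T\setminus\{t\})<c_G(T)$. For a field $K$, the binomial edge ideal of $G$ is the ideal $J_G=(x_uy_v-x_vy_u : \{u,v\}\in E(G))$ of $K[x_v,y_v : v\in V(G)]$; it is called unmixed if all its minimal primes have the same height. The graph $G$ is accessible if $J_G$ is unmixed and every non-empty cutset $T$ of $G$ contains an element $t$ such that $T\setminus\{t\}$ is again a cutset of $G$. A connected graph is $r$-connected if it remains connected after removing any set of fewer than $r$ vertices. For $r\ge 1$ let $K_r\star K_r$ be the disjoint union of two complete graphs on $x_1,\dots,x_r$ and $y_1,\dots,y_r$, together with the edges $\{x_i,y_i\}$ for $1\le i\le r$, and let $\overline{K_r\star K_r}$ be obtained from it by attaching one whisker (a new vertex joined only to that vertex) to each $x_i$ and each $y_i$ with $2\le i\le r$. **Proposition.** Let $K$ be a field and let $B$ be a non-complete block (a connected graph without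 cut vertices) that is $r$-regular and $r$-connected. Let $\overline{B}$ be a graph obtained from $B$ by attaching finitely many whiskers, i.e. new vertices, each joined to exactly one vertex of $B$ and to nothing else. If $\overline{B}$ is accessible, then $r\ge 2$ and $\overline{B}$ is isomorphic to $\overline{K_r\star K_r}$. -/

import Mathlib

namespace BinomialEdge

section Graphs

variable {V : Type*}

/-- `c_G(T)`: the number of connected components of `G \ T`. -/
noncomputable def numComp (G : SimpleGraph V) (T : Set V) : ℕ :=
  Nat.card (G.induce Tᶜ).ConnectedComponent

/-- `v` is a cut vertex of `G`: removing `v` increases the number of connected components. -/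
def IsCutVertex (G : SimpleGraph V) (v : V) : Prop :=
  numComp G ∅ < numComp G {v}

/-- `T` is a cutset of `G`: every `t ∈ T` is a cut vertex of `G \ (T \ {t})`, that is,
removing `t` from `G \ (T \ {t})` (which leaves `G \ T`) increases the number of
connected components. -/
def IsCutset (G : SimpleGraph V) (T : Set V) : Prop :=
  ∀ t ∈ T, numComp G (T \ {t}) < numComp G T

/-- `G`, regarded as a graph in its own right, is a block: it is connected and has no
cut vertex. -/
def IsBlock (G : SimpleGraph V) : Prop :=
  G.Connected ∧ ∀ v, ¬ IsCutVertex G v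

/-- `G` is `r`-connected: it is connected and stays so after the removal of any set of fewer
than `r` vertices. -/
def IsRConnected (r : ℕ) (G : SimpleGraph V) : Prop :=
  G.Connected ∧ ∀ S : Set V, S.Finite → S.ncard < r → (G.induce Sᶜ).Connected

/-- The binomial edge ideal `J_G`, generated by `x_u y_v - x_v y_u` over the edges `{u, v}`
of `G`; the variable `x_v` is `X (Sum.inl v)` and `y_v` is `X (Sum.inr v)`. -/
noncomputable def binomialEdgeIdeal (K : Type*) [Field K] (G : SimpleGraph V) :
    Ideal (MvPolynomial (V ⊕ V) K) :=
  Ideal.span {f | ∃ u v : V, G.Adj u v ∧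
    f = MvPolynomial.X (Sum.inl u) * MvPolynomial.X (Sum.inr v)
      - MvPolynomial.X (Sum.inl v) * MvPolynomial.X (Sum.inr u)}

/-- An ideal is unmixed if all its minimal primes have the same height. -/
def IsUnmixed {R : Type*} [CommRing R] (I : Ideal R) : Prop :=
  ∀ P ∈ I.minimalPrimes, ∀ Q ∈ I.minimalPrimes, P.height = Q.height

/-- `G` is accessible (over `K`): `J_G` is unmixed and every non-empty cutset `T` of `G` has
an element `t` such that `T \ {t}` is again a cutset. -/
def IsAccessible (K : Type*) [Field K] (G : SimpleGraph V) : Prop :=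
  IsUnmixed (binomialEdgeIdeal K G) ∧
    ∀ T : Set V, IsCutset G T → T.Nonempty → ∃ t ∈ T, IsCutset G (T \ {t})

/-- The graph obtained from `G` by attaching whiskers: for every `i : ι` there is a new vertex
`Sum.inr i`, joined to the vertex `p i` of `G` and to nothing else. -/
def attachWhiskers {ι : Type*} (G : SimpleGraph V) (p : ι → V) : SimpleGraph (V ⊕ ι) where
  Adj
    | Sum.inl u, Sum.inl v => G.Adj u v
    | Sum.inl u, Sum.inr i => p i = u
    | Sum.inr i, Sum.inl u => p i = u
    | Sum.inr _, Sum.inr _ => False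
  symm := ⟨by
    rintro (u | i) (v | j) h
    · exact SimpleGraph.Adj.symm h
    · exact h
    · exact h
    · exact h⟩
  loopless := ⟨by
    rintro (u | i) h
    · exact G.loopless.irrefl u h
    · exact h⟩

end Graphs

/-- The star product `K_r ⋆ K_r`: two disjoint complete graphs on `x_0, …, x_{r-1}` and
`y_0, …, y_{r-1}` together with the edges `{x_i, y_i}`; here `x_i = Sum.inl i` and
`y_i = Sum.inr i`. -/
def starProduct (r : ℕ) : SimpleGraph (Fin r ⊕ Fin r) where
  Adj
    | Sum.inl i, Sum.inl j => i ≠ j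
    | Sum.inr i, Sum.inr j => i ≠ j
    | Sum.inl i, Sum.inr j => i = j
    | Sum.inr i, Sum.inl j => i = j
  symm := ⟨by
    rintro (i | i) (j | j) h
    · exact Ne.symm h
    · exact Eq.symm h
    · exact Eq.symm h
    · exact Ne.symm h⟩
  loopless := ⟨by
    rintro (i | i) h
    · exact h rfl
    · exact h rfl⟩

/-- The vertices of `K_r ⋆ K_r` that carry a whisker: all but the first pair `x_0, y_0`. -/
def starWhiskerSet (r : ℕ) : Set (Fin r ⊕ Fin r) :=
  {v | Sum.elim Fin.val Fin.val v ≠ 0}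

/-- The whiskered star product: `K_r ⋆ K_r` with one whisker at each vertex
of `starWhiskerSet r`. -/
def whiskeredStar (r : ℕ) : SimpleGraph ((Fin r ⊕ Fin r) ⊕ starWhiskerSet r) :=
  attachWhiskers (starProduct r) (fun w : starWhiskerSet r => (w : Fin r ⊕ Fin r))

end BinomialEdge

/-!
Write `c(T)` for the number of components left after removing `T`. The algebra enters only through
one numerical consequence of unmixedness: `c(T) = |T| + c(∅)` for every cutset `T`
(`numComp_eq_of_isUnmixed`). For a cutset `T`, the ideal generated by the variables of `T` and the
`2`-minors inside the components of `G \ T` is a minimal prime of `J_G`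
(`cutIdeal_mem_minimalPrimes`) of height `|V| + |T| - c(T)` (`height_cutIdeal`). It is encoded as
the kernel of the parametrization `x_v ↦ X_v`, `y_v ↦ X_v Y_C` for `v` in a component `C`, and
`x_v, y_v ↦ 0` for `v ∈ T`. A smaller prime satisfying the evident equations contains this kernel,
because the parameters can be recovered in its residue field (`cutIdeal_le_of_isPrime`); this gives
minimality, and with Krull's height theorem the upper bound for the height. The lower bound comes
from specializing the coordinates one by one.

The rest is combinatorial. Let `W` be the set of whiskered vertices of `B`; unmixedness at single
vertices shows that no vertex carries two whiskers. As `B` is `r`-connected and not complete, every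
neighbourhood `N(v)` is a cutset, and accessibility forces exactly one vertex of `N(v)` to be
unwhiskered (`existsUnique_adj_unwhiskered`). Hence `W` is a cutset, its removal leaves `B` with
`c(W) = 1`, and the unwhiskered vertices form a single edge `u u'` (`exists_unwhiskered_edge`).
Every other vertex is adjacent to exactly one of `u`, `u'`. The neighbours of `u` other than `u'`
form a clique: otherwise the complement of a maximal independent set of them together with `u'`
would be a cutset leaving too many components (`adj_of_adj_unwhiskered`). So `B` is covered by two
cliques of size `r`, and regularity joins them by a perfect matching.
-/

namespace BinomialEdge

/-! ### Parametrized primes and their heights -/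

section Algebra

open MvPolynomial

variable {V : Type*} [DecidableEq V]

/-- The images of the variables after specializing those in `S`: a variable of a vertex of `T` is
sent to `0`, and the variable `Y_v` of a vertex `v ∉ T` to `Y_{ρ v}`. The set `S` is meant to be
contained in `specSet T ρ`; the value at `X_v` with `v ∉ T` is irrelevant. -/
noncomputable def specVar (K : Type*) [Field K] (T : Finset V) (ρ : V → V) (S : Finset (V ⊕ V)) :
    V ⊕ V → MvPolynomial (V ⊕ V) K := fun w =>
  if w ∈ S then Sum.elim (fun _ => 0) (fun v => if v ∈ T then 0 else X (Sum.inr (ρ v))) w else X w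

/-- The homomorphism `x_v ↦ X_v`, `y_v ↦ Y_v` for `v ∈ T` and `x_v ↦ X_v`, `y_v ↦ X_v Y_v` for
`v ∉ T`, followed by the specialization of the variables in `S`. -/
noncomputable def paramHom (K : Type*) [Field K] (T : Finset V) (ρ : V → V) (S : Finset (V ⊕ V)) :
    MvPolynomial (V ⊕ V) K →ₐ[K] MvPolynomial (V ⊕ V) K :=
  aeval (Sum.elim (fun v => specVar K T ρ S (Sum.inl v))
    (fun v => if v ∈ T then specVar K T ρ S (Sum.inr v)
      else X (Sum.inl v) * specVar K T ρ S (Sum.inr v)))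

/-- The variables that are specialized: both variables of each `v ∈ T`, and `Y_v` for each
`v ∉ T` that is not its own representative. -/
def specSet [Fintype V] (T : Finset V) (ρ : V → V) : Finset (V ⊕ V) :=
  T.disjSum (T ∪ Finset.univ.filter fun v => ρ v ≠ v)

/-- The equation that specializing the variable `w` imposes on the coordinates. -/
noncomputable def specEqn (K : Type*) [Field K] (T : Finset V) (ρ : V → V) :
    V ⊕ V → MvPolynomial (V ⊕ V) K :=
  Sum.elim (fun v => X (Sum.inl v)) (fun v => if v ∈ T then X (Sum.inr v) else
    X (Sum.inl (ρ v)) * X (Sum.inr v) - X (Sum.inl v) * X (Sum.inr (ρ v)))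

/-- The prime ideal attached to `T` and a choice `ρ` of representatives of the components outside
`T`: it is generated by the variables of `T` and the `2`-minors inside the components, but it is
encoded as the kernel of its parametrization, so that primality is automatic. -/
noncomputable def cutIdeal (K : Type*) [Field K] [Fintype V] (T : Finset V) (ρ : V → V) :
    Ideal (MvPolynomial (V ⊕ V) K) :=
  RingHom.ker (paramHom K T ρ (specSet T ρ))

variable (K : Type*) [Field K]

/-- `ρ` picks idempotently, for each vertex outside `T`, a representative outside `T`. -/
def IsRepr (T : Finset V) (ρ : V → V) : Prop :=
  ∀ v ∉ T, ρ v ∉ T ∧ ρ (ρ v) = ρ v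

instance isPrime_ker_paramHom (T : Finset V) (ρ : V → V) (S : Finset (V ⊕ V)) :
    (RingHom.ker (paramHom K T ρ S)).IsPrime := RingHom.ker_isPrime _

instance isPrime_cutIdeal [Fintype V] (T : Finset V) (ρ : V → V) :
    (cutIdeal K T ρ).IsPrime := isPrime_ker_paramHom K T ρ _

variable {T : Finset V} {ρ : V → V}

lemma paramHom_X_inl (S : Finset (V ⊕ V)) (v : V) :
    paramHom K T ρ S (X (Sum.inl v)) = specVar K T ρ S (Sum.inl v) := by simp [paramHom]

lemma paramHom_X_inr (S : Finset (V ⊕ V)) (v : V) :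
    paramHom K T ρ S (X (Sum.inr v)) = if v ∈ T then specVar K T ρ S (Sum.inr v)
      else X (Sum.inl v) * specVar K T ρ S (Sum.inr v) := by simp [paramHom]

variable [Fintype V]

lemma paramHom_specSet_inl (v : V) :
    paramHom K T ρ (specSet T ρ) (X (Sum.inl v)) = if v ∈ T then 0 else X (Sum.inl v) := by
  simp [paramHom_X_inl, specVar, specSet]

lemma paramHom_specSet_inr (v : V) :
    paramHom K T ρ (specSet T ρ) (X (Sum.inr v)) =
      if v ∈ T then 0 else X (Sum.inl v) * X (Sum.inr (ρ v)) := by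
  by_cases hv : v ∈ T <;> by_cases h : ρ v = v <;>
    simp [paramHom_X_inr, specVar, specSet, hv, h]

lemma X_mem_cutIdeal {v : V} (hv : v ∈ T) :
    X (Sum.inl v) ∈ cutIdeal K T ρ ∧ X (Sum.inr v) ∈ cutIdeal K T ρ := by
  simp [cutIdeal, RingHom.mem_ker, paramHom_specSet_inl, paramHom_specSet_inr, hv]

lemma X_inl_notMem_cutIdeal {v : V} (hv : v ∉ T) : X (Sum.inl v) ∉ cutIdeal K T ρ := by
  simp [cutIdeal, RingHom.mem_ker, paramHom_specSet_inl, hv]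

lemma minor_mem_cutIdeal_iff {u v : V} (hu : u ∉ T) (hv : v ∉ T) :
    X (Sum.inl u) * X (Sum.inr v) - X (Sum.inl v) * X (Sum.inr u) ∈ cutIdeal K T ρ ↔
      ρ u = ρ v := by
  have : (X (Sum.inl u) * (X (Sum.inl v) * X (Sum.inr (ρ v))) -
      X (Sum.inl v) * (X (Sum.inl u) * X (Sum.inr (ρ u))) : MvPolynomial (V ⊕ V) K) =
      X (Sum.inl u) * X (Sum.inl v) * (X (Sum.inr (ρ v)) - X (Sum.inr (ρ u))) := by ring
  simp only [cutIdeal, RingHom.mem_ker, map_sub, map_mul, paramHom_specSet_inl,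
    paramHom_specSet_inr, if_neg hu, if_neg hv, this]
  simp only [mul_eq_zero, X_ne_zero, false_or, sub_eq_zero]
  rw [(X_injective (R := K)).eq_iff, Sum.inr_injective.eq_iff, eq_comm]

/-- A prime ideal containing the equations of the parametrization, and no `x`-coordinate of a
representative, contains `cutIdeal K T ρ`: in the fraction field of the quotient the parameters
`X_v` and `Y_v` can be recovered as `x_v` and `y_v / x_v`, so the quotient map factors through
the parametrization. -/
lemma cutIdeal_le_of_isPrime (Q : Ideal (MvPolynomial (V ⊕ V) K)) [Q.IsPrime]
    (h0 : ∀ v ∈ T, X (Sum.inl v) ∈ Q ∧ X (Sum.inr v) ∈ Q)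
    (h1 : ∀ v ∉ T, X (Sum.inl (ρ v)) * X (Sum.inr v) - X (Sum.inl v) * X (Sum.inr (ρ v)) ∈ Q)
    (h2 : ∀ v ∉ T, X (Sum.inl (ρ v)) ∉ Q) : cutIdeal K T ρ ≤ Q := by
  let F := FractionRing (MvPolynomial (V ⊕ V) K ⧸ Q)
  let π : MvPolynomial (V ⊕ V) K →ₐ[K] F :=
    (IsScalarTower.toAlgHom K (MvPolynomial (V ⊕ V) K ⧸ Q) F).comp (Ideal.Quotient.mkₐ K Q)
  have hπ : ∀ f, π f = 0 ↔ f ∈ Q := fun f => by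
    have : π f = algebraMap (MvPolynomial (V ⊕ V) K ⧸ Q) F (Ideal.Quotient.mk Q f) := rfl
    rw [this, IsFractionRing.to_map_eq_zero_iff, Ideal.Quotient.eq_zero_iff_mem]
  let ψ : MvPolynomial (V ⊕ V) K →ₐ[K] F :=
    aeval (Sum.elim (fun v => π (X (Sum.inl v)))
      (fun v => π (X (Sum.inr v)) / π (X (Sum.inl v))))
  have key : ψ.comp (paramHom K T ρ (specSet T ρ)) = π := by
    ext w
    rcases w with v | v
    · by_cases hv : v ∈ T
      · simp [paramHom_specSet_inl, hv, (hπ _).2 (h0 v hv).1]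
      · simp [paramHom_specSet_inl, hv, ψ]
    · by_cases hv : v ∈ T
      · simp [paramHom_specSet_inr, hv, (hπ _).2 (h0 v hv).2]
      · have h3 : π (X (Sum.inl (ρ v))) ≠ 0 := fun h => h2 v hv ((hπ _).1 h)
        have h4 := (hπ _).2 (h1 v hv)
        simp only [map_sub, map_mul, sub_eq_zero] at h4
        simp only [AlgHom.comp_apply, paramHom_specSet_inr, if_neg hv, map_mul, ψ, aeval_X,
          Sum.elim_inl, Sum.elim_inr]
        rw [← mul_div_assoc, ← h4, mul_div_cancel_left₀ _ h3]
  intro f hf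
  rw [← hπ, ← key, AlgHom.comp_apply, show paramHom K T ρ (specSet T ρ) f = 0 from hf, map_zero]

lemma specVar_of_subset {S S' : Finset (V ⊕ V)} (hρ : IsRepr T ρ) (hS : S ⊆ S')
    (hS' : S' ⊆ specSet T ρ) (w : V ⊕ V) :
    aeval (specVar K T ρ S') (specVar K T ρ S w) = specVar K T ρ S' w := by
  by_cases h : w ∈ S
  · have h' := hS h
    rcases w with v | v
    · simp [specVar, h, h']
    · by_cases hv : v ∈ T
      · simp [specVar, h, h', hv]
      · have h3 : Sum.inr (ρ v) ∉ S' := fun h => by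
          have := hS' h
          simp [specSet, hρ v hv] at this
        simp [specVar, h, h', hv, h3]
  · simp [specVar, h]

lemma paramHom_comp {S S' : Finset (V ⊕ V)} (hρ : IsRepr T ρ) (hS : S ⊆ S')
    (hS' : S' ⊆ specSet T ρ) :
    (aeval (specVar K T ρ S')).comp (paramHom K T ρ S) = paramHom K T ρ S' := by
  have key := specVar_of_subset K hρ hS hS'
  refine MvPolynomial.algHom_ext fun w => ?_
  rcases w with v | v
  · rw [AlgHom.comp_apply, paramHom_X_inl, paramHom_X_inl, key]
  · by_cases hv : v ∈ T
    · simp only [AlgHom.comp_apply, paramHom_X_inr, if_pos hv, key]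
    · have : Sum.inl v ∉ S' := fun h => by
        have := hS' h
        simp [specSet, hv] at this
      simp only [AlgHom.comp_apply, paramHom_X_inr, if_neg hv, map_mul, key, aeval_X]
      simp [specVar, this]

lemma paramHom_specEqn_eq_zero_iff {S : Finset (V ⊕ V)} (hρ : IsRepr T ρ)
    (hS : S ⊆ specSet T ρ) {w : V ⊕ V} (hw : w ∈ specSet T ρ) :
    paramHom K T ρ S (specEqn K T ρ w) = 0 ↔ w ∈ S := by
  rcases w with v | v
  · by_cases h : Sum.inl v ∈ S <;> simp [specEqn, paramHom_X_inl, specVar, h]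
  · by_cases hv : v ∈ T
    · by_cases h : Sum.inr v ∈ S <;> simp [specEqn, paramHom_X_inr, specVar, h, hv]
    · have hne : ρ v ≠ v := by simpa [specSet, hv] using hw
      obtain ⟨h1, h2⟩ := hρ v hv
      have h3 : Sum.inr (ρ v) ∉ S := fun h => by
        have := hS h
        simp [specSet, h1, h2] at this
      have h4 : ∀ u ∉ T, Sum.inl u ∉ S := fun u hu h => by
        have := hS h
        simp [specSet, hu] at this
      have e : paramHom K T ρ S (specEqn K T ρ (Sum.inr v)) =
          X (Sum.inl (ρ v)) * X (Sum.inl v) *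
            (specVar K T ρ S (Sum.inr v) - X (Sum.inr (ρ v))) := by
        simp only [specEqn, Sum.elim_inr, if_neg hv, map_sub, map_mul, paramHom_X_inr, if_neg h1,
          paramHom_X_inl]
        simp only [specVar, if_neg h3, if_neg (h4 _ h1), if_neg (h4 _ hv)]
        ring
      rw [e]
      by_cases h : Sum.inr v ∈ S
      · simp [specVar, h, hv]
      · simp [specVar, h, sub_eq_zero, Ne.symm hne]

/-- Specializing the variables one at a time gives a strictly increasing chain of primes. -/
lemma card_le_height_ker_paramHom (hρ : IsRepr T ρ) (S : Finset (V ⊕ V))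
    (hS : S ⊆ specSet T ρ) : (S.card : ℕ∞) ≤ (RingHom.ker (paramHom K T ρ S)).height := by
  induction S using Finset.induction_on with
  | empty => simp
  | insert w S hw ih =>
    have hS0 : S ⊆ specSet T ρ := (Finset.subset_insert _ _).trans hS
    have hlt : RingHom.ker (paramHom K T ρ S) < RingHom.ker (paramHom K T ρ (insert w S)) := by
      refine SetLike.lt_iff_le_and_exists.2 ⟨fun f hf => ?_, specEqn K T ρ w, ?_, ?_⟩
      · rw [RingHom.mem_ker] at hf ⊢
        rw [← paramHom_comp K hρ (Finset.subset_insert w S) hS, AlgHom.comp_apply, hf, map_zero]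
      · rw [RingHom.mem_ker,
          paramHom_specEqn_eq_zero_iff K hρ hS (hS (Finset.mem_insert_self _ _))]
        exact Finset.mem_insert_self _ _
      · rw [RingHom.mem_ker,
          paramHom_specEqn_eq_zero_iff K hρ hS0 (hS (Finset.mem_insert_self _ _))]
        exact hw
    rw [Finset.card_insert_of_notMem hw, Nat.cast_add, Nat.cast_one]
    exact (add_le_add_left (ih hS0) 1).trans (Ideal.height_add_one_le_of_lt_of_isPrime hlt)

/-- The upper bound is Krull's height theorem: `cutIdeal K T ρ` is minimal over the ideal of the
equations `specEqn`. -/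
lemma height_cutIdeal (hρ : IsRepr T ρ) :
    (cutIdeal K T ρ).height = ((specSet T ρ).card : ℕ∞) := by
  classical
  refine le_antisymm ?_ (card_le_height_ker_paramHom K hρ _ subset_rfl)
  let s : Finset (MvPolynomial (V ⊕ V) K) := (specSet T ρ).image (specEqn K T ρ)
  have hmin : cutIdeal K T ρ ∈ (Ideal.span (s : Set (MvPolynomial (V ⊕ V) K))).minimalPrimes := by
    refine ⟨⟨inferInstance, ?_⟩, ?_⟩
    · rw [Ideal.span_le]
      intro f hf
      obtain ⟨w, hw, rfl⟩ := Finset.mem_image.1 (Finset.mem_coe.1 hf)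
      exact (paramHom_specEqn_eq_zero_iff K hρ subset_rfl hw).2 hw
    · rintro Q ⟨hQ, hsQ⟩ hle
      have hmem : ∀ w ∈ specSet T ρ, specEqn K T ρ w ∈ Q := fun w hw =>
        hsQ (Ideal.subset_span (Finset.mem_coe.2 (Finset.mem_image_of_mem _ hw)))
      refine cutIdeal_le_of_isPrime K Q (fun v hv => ⟨?_, ?_⟩) (fun v hv => ?_)
        (fun v hv h => X_inl_notMem_cutIdeal K (hρ v hv).1 (hle h))
      · simpa [specEqn] using hmem (Sum.inl v) (by simp [specSet, hv])
      · simpa [specEqn, hv] using hmem (Sum.inr v) (by simp [specSet, hv])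
      · by_cases h : ρ v = v
        · simp [h]
        · simpa [specEqn, hv] using hmem (Sum.inr v) (by simp [specSet, h])
  exact (Ideal.height_le_card_of_mem_minimalPrimes_span_finset hmin).trans
    (by exact_mod_cast Finset.card_image_le)

end Algebra

/-! ### Counting connected components -/

section Components

variable {V : Type*} {G : SimpleGraph V}

lemma eq_of_reachable_of_forall_adj {α : Type*} {f : V → α} (h : ∀ u v, G.Adj u v → f u = f v)
    {u v : V} (huv : G.Reachable u v) : f u = f v :=
  congrArg (SimpleGraph.ConnectedComponent.lift f fun u v p _ => by
    induction p with
    | nil => rfl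
    | cons hadj _ ih => exact (h _ _ hadj).trans (ih (by simp_all)))
    (SimpleGraph.ConnectedComponent.sound huv)

lemma numComp_eq_card {α : Type*} {T : Set V} (f : ↥Tᶜ → α) (hf : Function.Surjective f)
    (h1 : ∀ u v : ↥Tᶜ, G.Adj u v → f u = f v)
    (h2 : ∀ u v, f u = f v → (G.induce Tᶜ).Reachable u v) : numComp G T = Nat.card α := by
  have h3 : ∀ u v, (G.induce Tᶜ).Reachable u v → f u = f v := fun u v =>
    eq_of_reachable_of_forall_adj (fun u v h => h1 u v h)
  refine Nat.card_congr (Equiv.ofBijective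
    (SimpleGraph.ConnectedComponent.lift f fun u v p _ => h3 u v ⟨p⟩) ⟨?_, ?_⟩)
  · intro c d
    induction c using SimpleGraph.ConnectedComponent.ind with | _ u
    induction d using SimpleGraph.ConnectedComponent.ind with | _ v
    exact fun h => SimpleGraph.ConnectedComponent.sound (h2 u v h)
  · intro a
    obtain ⟨u, rfl⟩ := hf a
    exact ⟨SimpleGraph.connectedComponentMk _ u, rfl⟩

lemma numComp_eq_one_of_connected {T : Set V} (h : (G.induce Tᶜ).Connected) :
    numComp G T = 1 := by
  rw [numComp_eq_card (fun _ => ()) (fun _ => ⟨h.nonempty.some, rfl⟩) (fun _ _ _ => rfl)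
    (fun u v _ => h.preconnected u v)]
  simp

lemma reachable_of_numComp_eq_one {T : Set V} (h : numComp G T = 1) (u v : ↥Tᶜ) :
    (G.induce Tᶜ).Reachable u v := by
  have := (Nat.card_eq_one_iff_unique.1 h).1
  exact SimpleGraph.ConnectedComponent.exact (Subsingleton.elim _ _)

variable [Finite V]

lemma one_lt_numComp_of_not_reachable {T : Set V} {u v : ↥Tᶜ}
    (h : ¬ (G.induce Tᶜ).Reachable u v) : 1 < numComp G T :=
  Finite.one_lt_card_iff_nontrivial.2
    ⟨_, _, fun e => h (SimpleGraph.ConnectedComponent.exact e)⟩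

/-- A vertex of a cutset is adjacent to two distinct components of the remaining graph. -/
lemma exists_adj_of_numComp_lt {T : Set V} {t : V} (h : numComp G (T \ {t}) < numComp G T) :
    ∃ u w : ↥Tᶜ, G.Adj t u ∧ G.Adj t w ∧ ¬ (G.induce Tᶜ).Reachable u w := by
  by_contra! hcon
  refine h.not_ge ?_
  have hle : Tᶜ ≤ (T \ {t})ᶜ := fun x hx hx' => hx hx'.1
  refine Nat.card_le_card_of_injective
    (SimpleGraph.ConnectedComponent.map (G.induceHomOfLE hle).toHom) ?_
  intro c d
  induction c using SimpleGraph.ConnectedComponent.ind with | _ u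
  induction d using SimpleGraph.ConnectedComponent.ind with | _ v
  intro hcd
  have hr := SimpleGraph.ConnectedComponent.exact hcd
  -- the component of `u` stays closed under adjacency when `t` is put back, if `t` is added to
  -- it as soon as `t` has a neighbour there
  have key := eq_of_reachable_of_forall_adj (G := G.induce (T \ {t})ᶜ)
    (f := fun x => (∃ h : x.1 ∈ Tᶜ, (G.induce Tᶜ).Reachable u ⟨x.1, h⟩) ∨
      (x.1 = t ∧ ∃ y : ↥Tᶜ, G.Adj t y ∧ (G.induce Tᶜ).Reachable u y)) (by
    have : ∀ x y : ↥(T \ {t})ᶜ, G.Adj x y →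
        ((∃ h : x.1 ∈ Tᶜ, (G.induce Tᶜ).Reachable u ⟨x.1, h⟩) ∨
          (x.1 = t ∧ ∃ y : ↥Tᶜ, G.Adj t y ∧ (G.induce Tᶜ).Reachable u y)) →
        ((∃ h : y.1 ∈ Tᶜ, (G.induce Tᶜ).Reachable u ⟨y.1, h⟩) ∨
          (y.1 = t ∧ ∃ y : ↥Tᶜ, G.Adj t y ∧ (G.induce Tᶜ).Reachable u y)) := by
      rintro ⟨x, hx⟩ ⟨y, hy⟩ hxy (⟨hxT, hux⟩ | ⟨hxt, z, hz, huz⟩)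
      · by_cases hyt : y = t
        · subst hyt
          exact Or.inr ⟨rfl, ⟨x, hxT⟩, hxy.symm, hux⟩
        · have hyT : y ∈ Tᶜ := fun h => hy ⟨h, hyt⟩
          refine Or.inl ⟨hyT, hux.trans (SimpleGraph.Adj.reachable ?_)⟩
          exact hxy
      · obtain rfl : x = t := hxt
        have hyT : y ∈ Tᶜ := fun h => hy ⟨h, fun e => hxy.ne e.symm⟩
        exact Or.inl ⟨hyT, huz.trans (hcon z ⟨y, hyT⟩ hz hxy)⟩
    exact fun x y hxy => propext ⟨this x y hxy, this y x hxy.symm⟩) hr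
  have hu : (∃ h : v.1 ∈ Tᶜ, (G.induce Tᶜ).Reachable u ⟨v.1, h⟩) ∨
      (v.1 = t ∧ ∃ y : ↥Tᶜ, G.Adj t y ∧ (G.induce Tᶜ).Reachable u y) :=
    key.mp (Or.inl ⟨u.2, SimpleGraph.Reachable.refl _⟩)
  rcases hu with ⟨_, h⟩ | ⟨hvt, y, hy, huy⟩
  · exact SimpleGraph.ConnectedComponent.sound h
  · exfalso
    by_cases ht : t ∈ T
    · exact v.2 (hvt ▸ ht)
    · rw [Set.sdiff_singleton_eq_self ht] at h
      exact h.false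

lemma numComp_diff_singleton_le {T : Set V} {t x : V} (hx : x ∉ T) (htx : G.Adj t x) :
    numComp G (T \ {t}) ≤ numComp G T := by
  have hle : Tᶜ ≤ (T \ {t})ᶜ := fun x hx hx' => hx hx'.1
  refine Nat.card_le_card_of_surjective
    (SimpleGraph.ConnectedComponent.map (G.induceHomOfLE hle).toHom) ?_
  intro c
  induction c using SimpleGraph.ConnectedComponent.ind with | _ v
  obtain ⟨v, hv⟩ := v
  by_cases hvt : v = t
  · subst hvt
    refine ⟨SimpleGraph.connectedComponentMk _ ⟨x, hx⟩, ?_⟩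
    refine SimpleGraph.ConnectedComponent.sound (SimpleGraph.Adj.reachable ?_)
    exact htx.symm
  · exact ⟨SimpleGraph.connectedComponentMk _ ⟨v, fun h => hv ⟨h, hvt⟩⟩, rfl⟩

end Components

/-! ### Minimal primes of the binomial edge ideal -/

section Unmixed

open MvPolynomial

variable {V : Type*} (K : Type*) [Field K] {G : SimpleGraph V}

/-- If the coordinate vector of `v` does not vanish modulo the prime `Q`, then being parallel
modulo `Q` is transitive through `v`. -/
lemma minor_mem_trans {Q : Ideal (MvPolynomial (V ⊕ V) K)} [Q.IsPrime] {u v w : V}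
    (hv : ¬ (X (Sum.inl v) ∈ Q ∧ X (Sum.inr v) ∈ Q))
    (h1 : X (Sum.inl u) * X (Sum.inr v) - X (Sum.inl v) * X (Sum.inr u) ∈ Q)
    (h2 : X (Sum.inl v) * X (Sum.inr w) - X (Sum.inl w) * X (Sum.inr v) ∈ Q) :
    X (Sum.inl u) * X (Sum.inr w) - X (Sum.inl w) * X (Sum.inr u) ∈ Q := by
  by_contra h
  refine hv ⟨(Ideal.IsPrime.mem_or_mem ‹_› (?_ : _ * _ ∈ Q)).resolve_right h,
    (Ideal.IsPrime.mem_or_mem ‹_› (?_ : _ * _ ∈ Q)).resolve_right h⟩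
  · convert Q.add_mem (Q.mul_mem_left (X (Sum.inl u)) h2) (Q.mul_mem_left (X (Sum.inl w)) h1)
      using 1
    ring
  · convert Q.add_mem (Q.mul_mem_left (X (Sum.inr u)) h2) (Q.mul_mem_left (X (Sum.inr w)) h1)
      using 1
    ring

variable [DecidableEq V]

/-- `ρ` chooses a representative in each connected component of `G \ T`. -/
structure IsComponentRepr (G : SimpleGraph V) (T : Finset V) (ρ : V → V) : Prop where
  isRepr : IsRepr T ρ
  reachable_iff : ∀ u v : ↥((T : Set V)ᶜ), (G.induce (T : Set V)ᶜ).Reachable u v ↔ ρ u = ρ v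

lemma exists_isComponentRepr (G : SimpleGraph V) (T : Finset V) :
    ∃ ρ, IsComponentRepr G T ρ := by
  let H := G.induce (T : Set V)ᶜ
  let rep : ↥((T : Set V)ᶜ) → ↥((T : Set V)ᶜ) := fun v => (H.connectedComponentMk v).out
  have hrep : ∀ v, H.connectedComponentMk (rep v) = H.connectedComponentMk v :=
    fun v => Quot.out_eq _
  let ρ : V → V := fun v => if h : v ∈ T then v else rep ⟨v, by simpa using h⟩
  have hρ : ∀ v : ↥((T : Set V)ᶜ), ρ v = rep v := fun v => by
    have : v.1 ∉ T := fun h => v.2 h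
    simp [ρ, this]
  refine ⟨ρ, fun v hv => ?_, fun u v => ?_⟩
  · have h1 := hρ ⟨v, by simpa using hv⟩
    simp only at h1
    rw [h1, hρ]
    refine ⟨fun h => (rep ⟨v, by simpa using hv⟩).2 h, ?_⟩
    exact congrArg Subtype.val (congrArg Quot.out (hrep _))
  · rw [hρ, hρ, Subtype.val_injective.eq_iff]
    constructor
    · intro h
      exact congrArg Quot.out (SimpleGraph.ConnectedComponent.sound h)
    · intro h
      apply SimpleGraph.ConnectedComponent.exact
      rw [← hrep u, ← hrep v, h]

variable [Fintype V]

lemma card_specSet_add_numComp {T : Finset V} {ρ : V → V} (h : IsComponentRepr G T ρ) :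
    (specSet T ρ).card + numComp G T = Fintype.card V + T.card := by
  have h1 : numComp G (T : Set V) =
      ((T ∪ Finset.univ.filter fun v => ρ v ≠ v)ᶜ : Finset V).card := by
    rw [numComp_eq_card (α := ((T ∪ Finset.univ.filter fun v => ρ v ≠ v)ᶜ : Finset V))
      (fun v => ⟨ρ v, by
        have := h.isRepr v (fun h => v.2 h)
        simp [this]⟩)]
    · rw [Nat.card_eq_fintype_card, Fintype.card_coe]
    · rintro ⟨v, hv⟩
      simp only [Finset.mem_compl, Finset.mem_union, Finset.mem_filter, Finset.mem_univ,
        true_and, not_or, not_not] at hv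
      exact ⟨⟨v, by simpa using hv.1⟩, Subtype.ext hv.2⟩
    · intro u v huv
      exact Subtype.ext ((h.reachable_iff u v).1 (SimpleGraph.Adj.reachable huv))
    · intro u v huv
      exact (h.reachable_iff u v).2 (congrArg Subtype.val huv)
  rw [h1, Finset.card_compl, specSet, Finset.card_disjSum]
  have := Finset.card_le_univ (T ∪ Finset.univ.filter fun v => ρ v ≠ v)
  omega

/-- Cutsets give minimal primes of the binomial edge ideal. Over a smaller prime `Q`, a vertex of
`T` outside the zero locus of `Q` would make the two components it joins parallel, so `Q` kills
exactly the variables of `T`. -/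
lemma cutIdeal_mem_minimalPrimes {T : Finset V} {ρ : V → V} (h : IsComponentRepr G T ρ)
    (hT : IsCutset G (T : Set V)) :
    cutIdeal K T ρ ∈ (binomialEdgeIdeal K G).minimalPrimes := by
  refine ⟨⟨inferInstance, ?_⟩, ?_⟩
  · rw [binomialEdgeIdeal, Ideal.span_le]
    rintro f ⟨u, v, huv, rfl⟩
    by_cases hu : u ∈ T
    · exact Ideal.sub_mem _ (Ideal.mul_mem_right _ _ (X_mem_cutIdeal K hu).1)
        (Ideal.mul_mem_left _ _ (X_mem_cutIdeal K hu).2)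
    by_cases hv : v ∈ T
    · exact Ideal.sub_mem _ (Ideal.mul_mem_left _ _ (X_mem_cutIdeal K hv).2)
        (Ideal.mul_mem_right _ _ (X_mem_cutIdeal K hv).1)
    refine (minor_mem_cutIdeal_iff K hu hv).2 ?_
    exact (h.reachable_iff ⟨u, by simpa using hu⟩ ⟨v, by simpa using hv⟩).1
      (SimpleGraph.Adj.reachable huv)
  · rintro Q ⟨hQ, hJQ⟩ hle
    have hadj : ∀ u v, G.Adj u v →
        X (Sum.inl u) * X (Sum.inr v) - X (Sum.inl v) * X (Sum.inr u) ∈ Q :=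
      fun u v huv => hJQ (Ideal.subset_span ⟨u, v, huv, rfl⟩)
    have hnot : ∀ v ∉ T, X (Sum.inl v) ∉ Q := fun v hv hx => X_inl_notMem_cutIdeal K hv (hle hx)
    refine cutIdeal_le_of_isPrime K Q (fun t ht => ?_) (fun v hv => ?_)
      (fun v hv => hnot _ (h.isRepr v hv).1)
    · by_contra hcon
      obtain ⟨u, w, hu, hw, hne⟩ := exists_adj_of_numComp_lt (hT t ht)
      refine hne ((h.reachable_iff u w).2 ?_)
      exact (minor_mem_cutIdeal_iff K (fun h => u.2 h) (fun h => w.2 h)).1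
        (hle (minor_mem_trans K hcon (hadj _ _ hu.symm) (hadj _ _ hw)))
    · have hr : (G.induce (T : Set V)ᶜ).Reachable ⟨ρ v, by simpa using (h.isRepr v hv).1⟩
          ⟨v, by simpa using hv⟩ := (h.reachable_iff _ _).2 (h.isRepr v hv).2
      have hwalk : ∀ a b : ↥((T : Set V)ᶜ), (G.induce (T : Set V)ᶜ).Walk a b →
          X (Sum.inl a.1) * X (Sum.inr b.1) - X (Sum.inl b.1) * X (Sum.inr a.1) ∈ Q := by
        intro a b p
        induction p with
        | nil => simp
        | @cons a c b hac _ ih =>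
          exact minor_mem_trans K (fun hc => hnot c (fun h => c.2 h) hc.1) (hadj _ _ hac) ih
      obtain ⟨p⟩ := hr
      have := hwalk _ _ p
      exact this

end Unmixed

/-- Comparing the heights of the minimal primes of `T` and of the empty cutset. -/
theorem numComp_eq_of_isUnmixed {V : Type*} [Finite V] {K : Type*} [Field K] {G : SimpleGraph V}
    (hU : IsUnmixed (binomialEdgeIdeal K G)) {T : Set V} (hT : IsCutset G T) :
    numComp G T = T.ncard + numComp G ∅ := by
  classical
  have := Fintype.ofFinite V
  have key : ∀ S : Finset V, IsCutset G (S : Set V) →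
      ∃ P ∈ (binomialEdgeIdeal K G).minimalPrimes, ∃ n : ℕ, P.height = n ∧
        n + numComp G S = Fintype.card V + S.card := fun S hS => by
    obtain ⟨ρ, hρ⟩ := exists_isComponentRepr G S
    exact ⟨_, cutIdeal_mem_minimalPrimes K hρ hS, _, height_cutIdeal K hρ.isRepr,
      card_specSet_add_numComp hρ⟩
  obtain ⟨P, hP, n, hn, h1⟩ := key T.toFinite.toFinset (by simpa using hT)
  obtain ⟨Q, hQ, m, hm, h2⟩ := key ∅ (by simp [IsCutset])
  have h3 := hU P hP Q hQ
  rw [hn, hm, Nat.cast_inj] at h3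
  rw [Set.Finite.coe_toFinset, ← Set.ncard_eq_toFinset_card T] at h1
  simp only [Finset.coe_empty, Finset.card_empty] at h2
  omega

/-! ### Cutsets of whiskered graphs -/

section Whiskers

variable {V ι : Type*} {B : SimpleGraph V} {p : ι → V}

/-- Each whisker attached to a vertex of `S` contributes an isolated vertex. -/
lemma numComp_attachWhiskers [Finite V] [Finite ι] (B : SimpleGraph V) (p : ι → V) (S : Set V) :
    numComp (attachWhiskers B p) (Sum.inl '' S) = numComp B S + Nat.card {i // p i ∈ S} := by
  classical
  let H := B.induce Sᶜ
  let H' := (attachWhiskers B p).induce (Sum.inl '' S)ᶜ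
  have hmem : ∀ {v : V}, (Sum.inl v : V ⊕ ι) ∈ (Sum.inl '' S : Set (V ⊕ ι))ᶜ ↔ v ∈ Sᶜ := by simp
  let φ : H →g H' := ⟨fun v => ⟨Sum.inl v.1, hmem.2 v.2⟩, fun h => h⟩
  let g : V ⊕ ι → H.ConnectedComponent ⊕ {i // p i ∈ S} → Prop := fun x c =>
    Sum.elim (fun v => ∃ h : v ∈ Sᶜ, c = Sum.inl (H.connectedComponentMk ⟨v, h⟩))
      (fun i => (∃ h : p i ∈ Sᶜ, c = Sum.inl (H.connectedComponentMk ⟨p i, h⟩)) ∨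
        ∃ h : p i ∈ S, c = Sum.inr ⟨i, h⟩) x
  have hg : ∀ x : ↥((Sum.inl '' S : Set (V ⊕ ι))ᶜ), ∃ c, g x c := by
    rintro ⟨v | i, hx⟩
    · exact ⟨_, hmem.1 hx, rfl⟩
    · by_cases h : p i ∈ S
      · exact ⟨_, Or.inr ⟨h, rfl⟩⟩
      · exact ⟨_, Or.inl ⟨h, rfl⟩⟩
  choose f hf using hg
  have hfl : ∀ v (h : v ∈ Sᶜ), f ⟨Sum.inl v, hmem.2 h⟩ =
      Sum.inl (H.connectedComponentMk ⟨v, h⟩) := fun v h => by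
    obtain ⟨_, h'⟩ := hf ⟨Sum.inl v, hmem.2 h⟩
    exact h'
  have hfr : ∀ i (h : p i ∈ S) hx, f ⟨Sum.inr i, hx⟩ = Sum.inr ⟨i, h⟩ := fun i h hx => by
    obtain ⟨h', _⟩ | ⟨_, h'⟩ := hf ⟨Sum.inr i, hx⟩
    · exact absurd h h'
    · exact h'
  have hfr' : ∀ i (h : p i ∈ Sᶜ) hx, f ⟨Sum.inr i, hx⟩ =
      Sum.inl (H.connectedComponentMk ⟨p i, h⟩) := fun i h hx => by
    obtain ⟨_, h'⟩ | ⟨h', _⟩ := hf ⟨Sum.inr i, hx⟩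
    · exact h'
    · exact absurd h' h
  have hadj : ∀ u v : ↥((Sum.inl '' S : Set (V ⊕ ι))ᶜ),
      (attachWhiskers B p).Adj u v → f u = f v := by
    rintro ⟨u | i, hu⟩ ⟨v | j, hv⟩ h
    · rw [hfl u (hmem.1 hu), hfl v (hmem.1 hv)]
      exact congrArg Sum.inl (SimpleGraph.ConnectedComponent.sound (SimpleGraph.Adj.reachable h))
    · obtain rfl : p j = u := h
      rw [hfl _ (hmem.1 hu), hfr' j (hmem.1 hu)]
    · obtain rfl : p i = v := h
      rw [hfl _ (hmem.1 hv), hfr' i (hmem.1 hv)]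
    · exact h.elim
  -- every vertex either is a whisker on `S` or is joined to a vertex of `B` outside `S`
  have hcases : ∀ x : ↥((Sum.inl '' S : Set (V ⊕ ι))ᶜ),
      (∃ i, ∃ h : p i ∈ S, x.1 = Sum.inr i ∧ f x = Sum.inr ⟨i, h⟩) ∨
      ∃ v : ↥Sᶜ, H'.Reachable x (φ v) ∧ f x = Sum.inl (H.connectedComponentMk v) := by
    rintro ⟨v | i, hx⟩
    · exact Or.inr ⟨⟨v, hmem.1 hx⟩, SimpleGraph.Reachable.refl _, hfl v (hmem.1 hx)⟩
    · by_cases h : p i ∈ S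
      · exact Or.inl ⟨i, h, rfl, hfr i h hx⟩
      · exact Or.inr ⟨⟨p i, h⟩, SimpleGraph.Adj.reachable (show p i = p i from rfl),
          hfr' i h hx⟩
  rw [numComp_eq_card f, Nat.card_sum]
  · rfl
  · rintro (c | ⟨i, hi⟩)
    · induction c using SimpleGraph.ConnectedComponent.ind with | _ v
      exact ⟨_, hfl v.1 v.2⟩
    · exact ⟨⟨Sum.inr i, by simp⟩, hfr i hi _⟩
  · exact hadj
  · intro x y hxy
    obtain ⟨i, hi, hx, hfx⟩ | ⟨v, hx, hfx⟩ := hcases x <;>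
    obtain ⟨j, hj, hy, hfy⟩ | ⟨w, hy, hfy⟩ := hcases y
    · rw [hfx, hfy] at hxy
      obtain rfl : i = j := congrArg Subtype.val (Sum.inr_injective hxy)
      rw [Subtype.ext (hx.trans hy.symm)]
    · rw [hfx, hfy] at hxy
      cases hxy
    · rw [hfx, hfy] at hxy
      cases hxy
    · rw [hfx, hfy] at hxy
      have hvw : H.Reachable v w := SimpleGraph.ConnectedComponent.exact (Sum.inl_injective hxy)
      exact (hx.trans (hvw.map φ)).trans hy.symm

/-- `S` is a cutset of the graph obtained from `B` by attaching one whisker to each vertex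
of `W`, expressed through the components of `B` alone. -/
def IsWhiskerCutset (B : SimpleGraph V) (W S : Set V) : Prop :=
  ∀ s ∈ S, numComp B (S \ {s}) + ((S \ {s}) ∩ W).ncard < numComp B S + (S ∩ W).ncard

lemma card_whiskers_eq_ncard (hp : Function.Injective p) (S : Set V) :
    Nat.card {i // p i ∈ S} = (S ∩ Set.range p).ncard := by
  rw [← Set.image_preimage_eq_inter_range, Set.ncard_image_of_injective _ hp]
  rfl

lemma isCutset_image_inl_iff [Finite V] [Finite ι] (hp : Function.Injective p) (S : Set V) :
    IsCutset (attachWhiskers B p) (Sum.inl '' S) ↔ IsWhiskerCutset B (Set.range p) S := by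
  have hdiff : ∀ s : V, (Sum.inl '' S \ {Sum.inl s} : Set (V ⊕ ι)) = Sum.inl '' (S \ {s}) :=
    fun s => by rw [Set.image_sdiff Sum.inl_injective, Set.image_singleton]
  simp only [IsCutset, Set.forall_mem_image, hdiff, numComp_attachWhiskers,
    card_whiskers_eq_ncard hp,
    IsWhiskerCutset]

lemma isWhiskerCutset_of_forall [Finite V] {W S : Set V}
    (h : ∀ s ∈ S, (s ∈ W ∧ numComp B (S \ {s}) ≤ numComp B S) ∨
      numComp B (S \ {s}) < numComp B S) : IsWhiskerCutset B W S := by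
  intro s hs
  rcases h s hs with ⟨hsW, h⟩ | h
  · refine add_lt_add_of_le_of_lt h (Set.ncard_lt_ncard ?_)
    refine ⟨fun x hx => ⟨hx.1.1, hx.2⟩, fun hle => (hle ⟨hs, hsW⟩).1.2 rfl⟩
  · exact add_lt_add_of_lt_of_le h
      (Set.ncard_le_ncard (Set.inter_subset_inter_left _ Set.sdiff_subset))

/-- Attaching whiskers is functorial in isomorphisms. -/
def attachWhiskersIso {V' ι' : Type*} {B' : SimpleGraph V'} {p' : ι' → V'} (e : B ≃g B')
    (f : ι ≃ ι') (h : ∀ i, e (p i) = p' (f i)) :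
    attachWhiskers B p ≃g attachWhiskers B' p' where
  toEquiv := Equiv.sumCongr e.toEquiv f
  map_rel_iff' := by
    rintro (u | i) (v | j)
    · exact e.map_adj_iff
    · show p' (f j) = e u ↔ p j = u
      rw [← h, e.injective.eq_iff]
    · show p' (f i) = e v ↔ p i = v
      rw [← h, e.injective.eq_iff]
    · exact Iff.rfl

end Whiskers

/-! ### Star products and cliques -/

section Star

variable {V : Type*} [Fintype V] {B : SimpleGraph V}

/-- Two cliques covering the graph and joined by a perfect matching form a star product. -/
lemma exists_iso_starProduct {k : ℕ} {X Y : Set V} (hXY : ∀ v, v ∈ X ↔ v ∉ Y)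
    (hX : B.IsClique X) (hY : B.IsClique Y) (hcard : X.ncard = k + 1)
    (hXm : ∀ x ∈ X, ∃! y, y ∈ Y ∧ B.Adj x y) (hYm : ∀ y ∈ Y, ∃! x, x ∈ X ∧ B.Adj y x)
    {u u' : V} (hu : u ∈ X) (hu' : u' ∈ Y) (huu' : B.Adj u u') :
    ∃ e : B ≃g starProduct (k + 1), e u = Sum.inl 0 ∧ e u' = Sum.inr 0 := by
  classical
  have e0 : Fin (k + 1) ≃ X := (Finite.equivFinOfCardEq (by
    rw [Nat.card_coe_set_eq, hcard])).symm
  let e := e0.setValue 0 ⟨u, hu⟩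
  have he : (e 0).1 = u := congrArg Subtype.val (e0.setValue_eq 0 ⟨u, hu⟩)
  have he' : ∀ i j, (e i).1 = (e j).1 ↔ i = j := fun i j => by
    rw [Subtype.val_injective.eq_iff, e.injective.eq_iff]
  choose! σ hσ hσu using hXm
  have hσi : ∀ i j, B.Adj (e i) (σ (e j)) ↔ i = j := fun i j => by
    constructor
    · intro h
      have hj := hσ _ (e j).2
      exact (he' i j).1 ((hYm _ hj.1).unique ⟨(e i).2, h.symm⟩ ⟨(e j).2, hj.2.symm⟩)
    · rintro rfl
      exact (hσ _ (e i).2).2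
  have hσinj : ∀ i j, σ (e i) = σ (e j) ↔ i = j := fun i j =>
    ⟨fun h => (hσi i j).1 (h ▸ (hσi i i).2 rfl), fun h => h ▸ rfl⟩
  have hne : ∀ i j, (e i).1 ≠ σ (e j) := fun i j h =>
    (hXY _).1 (e i).2 (h ▸ (hσ _ (e j).2).1)
  let g : Fin (k + 1) ⊕ Fin (k + 1) → V := Sum.elim (fun i => (e i).1) (fun i => σ (e i))
  have hg : Function.Bijective g := by
    constructor
    · rintro (i | i) (j | j) h
      · exact congrArg _ ((he' i j).1 h)
      · exact (hne i j h).elim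
      · exact (hne j i h.symm).elim
      · exact congrArg _ ((hσinj i j).1 h)
    · intro v
      by_cases hv : v ∈ X
      · exact ⟨Sum.inl (e.symm ⟨v, hv⟩), by simp [g]⟩
      · have hvY : v ∈ Y := by
          by_contra h
          exact hv ((hXY v).2 h)
        obtain ⟨x, ⟨hx, hadj⟩, _⟩ := hYm v hvY
        refine ⟨Sum.inr (e.symm ⟨x, hx⟩), ?_⟩
        simpa [g] using (hσu x hx v ⟨hvY, hadj.symm⟩).symm
  let E : starProduct (k + 1) ≃g B :=
    { toEquiv := Equiv.ofBijective g hg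
      map_rel_iff' := by
        rintro (i | i) (j | j)
        · show B.Adj (e i) (e j) ↔ i ≠ j
          exact ⟨fun h hij => h.ne ((he' i j).2 hij),
            fun h => hX (e i).2 (e j).2 fun hij => h ((he' i j).1 hij)⟩
        · exact hσi i j
        · show B.Adj (σ (e i)) (e j) ↔ i = j
          rw [B.adj_comm, hσi, eq_comm]
        · show B.Adj (σ (e i)) (σ (e j)) ↔ i ≠ j
          exact ⟨fun h hij => h.ne ((hσinj i j).2 hij),
            fun h => hY (hσ _ (e i).2).1 (hσ _ (e j).2).1 fun hij => h ((hσinj i j).1 hij)⟩ }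
  refine ⟨E.symm, ?_, ?_⟩
  · rw [← he]
    exact E.symm_apply_apply (Sum.inl 0)
  · have : u' = σ (e 0) := by
      rw [he]
      exact hσu u hu u' ⟨hu', huu'⟩
    rw [this]
    exact E.symm_apply_apply (Sum.inr 0)

lemma existsUnique_adj_notMem_of_isClique {r : ℕ} (hdeg : ∀ v, (B.neighborSet v).ncard = r)
    {X : Set V} (hX : B.IsClique X) (hcard : X.ncard = r) {x : V} (hx : x ∈ X) :
    ∃! y, y ∉ X ∧ B.Adj x y := by
  have h1 : B.neighborSet x ∩ X = X \ {x} := by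
    ext y
    exact ⟨fun h => ⟨h.2, fun e => h.1.ne (Set.mem_singleton_iff.1 e).symm⟩,
      fun h => ⟨hX hx h.1 fun e => h.2 e.symm, h.1⟩⟩
  have h2 := Set.ncard_inter_add_ncard_sdiff_eq_ncard (B.neighborSet x) X
  have h3 := Set.ncard_sdiff_singleton_add_one hx
  rw [h1, hdeg] at h2
  obtain ⟨y, hy⟩ := Set.ncard_eq_one.1 (show (B.neighborSet x \ X).ncard = 1 by omega)
  have hy' : ∀ z, z ∉ X ∧ B.Adj x z ↔ z = y := fun z => by
    rw [← Set.mem_singleton_iff, ← hy, and_comm]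
    rfl
  exact ⟨y, (hy' y).2 rfl, fun z hz => (hy' z).1 hz⟩

/-- If `a, b` were non-adjacent, let `S` be a maximal independent set of neighbours of `u` other
than `u'` that contains them. Removing everything but `S` and `u'` is a cutset that contains
`u` as its only unwhiskered vertex, but it leaves at least three components. -/
lemma adj_of_adj_unwhiskered {W : Set V}
    (hU : ∀ S, IsWhiskerCutset B W S → numComp B S + (S ∩ W).ncard = S.ncard + 1)
    {u u' : V} (huW : u ∉ W) (huu' : B.Adj u u')
    (hW : ∀ x, x ∉ W → x = u ∨ x = u') (hor : ∀ v, B.Adj v u ∨ B.Adj v u')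
    (hnot : ∀ v, B.Adj v u → ¬ B.Adj v u') {a b : V} (hab : a ≠ b) (ha' : a ≠ u') (hb' : b ≠ u')
    (ha : B.Adj u a) (hb : B.Adj u b) : B.Adj a b := by
  by_contra hnab
  let P : Set V → Prop := fun S => (∀ x ∈ S, B.Adj u x ∧ x ≠ u') ∧ B.IsIndepSet S
  have hP0 : P {a, b} := by
    refine ⟨by rintro x (rfl | rfl) <;> simp [*], ?_⟩
    rintro x (rfl | rfl) y (rfl | rfl) hxy
    · exact (hxy rfl).elim
    · exact hnab
    · exact fun h => hnab h.symm
    · exact (hxy rfl).elim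
  obtain ⟨S, hle, hS⟩ := (Set.toFinite {S | P S}).exists_le_maximal hP0
  have haS : a ∈ S := hle (by simp)
  have hbS : b ∈ S := hle (by simp)
  have hSP : P S := hS.prop
  have huS : u ∉ S := fun h => (hSP.1 u h).1.ne rfl
  have hu'S : u' ∉ S := fun h => (hSP.1 u' h).2 rfl
  let T : Set V := (insert u' S)ᶜ
  have huT : u ∈ T := by
    rintro (h | h)
    exacts [huu'.ne h, huS h]
  have hTc : Tᶜ = insert u' S := compl_compl _
  have hindep : ∀ x y : ↥Tᶜ, ¬ B.Adj x y := by
    rintro ⟨x, hx⟩ ⟨y, hy⟩ hxy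
    rw [hTc] at hx hy
    rcases hx with hx' | hx' <;> rcases hy with hy' | hy'
    · exact hxy.ne (hx'.trans hy'.symm)
    · exact hnot y (hSP.1 y hy').1.symm (hx' ▸ hxy.symm)
    · exact hnot x (hSP.1 x hx').1.symm (hy' ▸ hxy)
    · exact hSP.2 hx' hy' hxy.ne hxy
  have hcT : numComp B T = (Tᶜ).ncard := by
    rw [numComp_eq_card (G := B) (id : ↥Tᶜ → ↥Tᶜ) Function.surjective_id
      (fun x y h => (hindep x y h).elim) (fun x y h => by
        obtain rfl : x = y := h
        exact SimpleGraph.Reachable.refl _), Nat.card_coe_set_eq]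
  have h3 : 3 ≤ (Tᶜ).ncard := by
    rw [hTc, Set.ncard_insert_of_notMem hu'S]
    have h4 := Set.ncard_le_ncard hle
    rw [Set.ncard_pair hab] at h4
    omega
  have hTu : numComp B (T \ {u}) = 1 := by
    apply numComp_eq_one_of_connected
    have huc : u ∈ (T \ {u})ᶜ := fun h => h.2 rfl
    rw [SimpleGraph.connected_iff_exists_forall_reachable]
    refine ⟨⟨u, huc⟩, fun ⟨x, hx⟩ => ?_⟩
    by_cases hxu : x = u
    · subst hxu
      rfl
    · have hxT : x ∈ Tᶜ := fun h => hx ⟨h, hxu⟩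
      rw [hTc] at hxT
      refine SimpleGraph.Adj.reachable (show B.Adj u x from ?_)
      rcases hxT with rfl | hxS
      exacts [huu', (hSP.1 x hxS).1]
  have hcut : IsWhiskerCutset B W T := by
    refine isWhiskerCutset_of_forall fun s hs => ?_
    by_cases hsu : s = u
    · right
      rw [hsu, hTu, hcT]
      omega
    · left
      have hsu' : s ≠ u' := fun h => hs (Or.inl h)
      refine ⟨by_contra fun h => (hW s h).elim hsu hsu', ?_⟩
      rcases hor s with hsadj | hsadj
      · have hsS : s ∉ S := fun h => hs (Or.inr h)
        obtain ⟨y, hyS, hsy⟩ : ∃ y ∈ S, B.Adj s y := by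
          by_contra! hcon
          refine hsS (hS.le_of_ge (y := insert s S) ⟨?_, ?_⟩ (Set.subset_insert _ _)
            (Set.mem_insert _ _))
          · rintro x (rfl | hx)
            exacts [⟨hsadj.symm, hsu'⟩, hSP.1 x hx]
          · rintro x (rfl | hx) y (rfl | hy) hxy
            · exact (hxy rfl).elim
            · exact hcon y hy
            · exact fun h => hcon x hx h.symm
            · exact hSP.2 hx hy hxy
        exact numComp_diff_singleton_le (fun h => h (Or.inr hyS)) hsy
      · exact numComp_diff_singleton_le (fun h => h (Or.inl rfl)) hsadj
  have hTW : T ∩ W = T \ {u} := by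
    ext x
    refine ⟨fun h => ⟨h.1, fun e => huW ((Set.mem_singleton_iff.1 e) ▸ h.2)⟩, fun h => ⟨h.1, ?_⟩⟩
    by_contra hx
    exact (hW x hx).elim h.2 fun e => h.1 (Or.inl e)
  have h5 := hU T hcut
  have h6 := Set.ncard_sdiff_singleton_add_one huT
  rw [hTW] at h5
  omega

end Star

/-! ### Regular blocks with accessible whiskering -/

section Core

variable {V : Type*} [Fintype V] {B : SimpleGraph V} {r : ℕ}

lemma exists_not_adj_of_ne_top (hnc : B ≠ ⊤) (hdeg : ∀ v, (B.neighborSet v).ncard = r) (v : V) :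
    ∃ z, z ≠ v ∧ ¬ B.Adj v z := by
  by_contra! hcon
  obtain ⟨a, b, hab, hnab⟩ : ∃ a b, a ≠ b ∧ ¬ B.Adj a b := by
    by_contra! h
    exact hnc (eq_top_iff.2 fun a b hab => h a b hab)
  have h1 : B.neighborSet v = Set.univ \ {v} := by
    ext x
    exact ⟨fun h => ⟨trivial, fun e => h.ne (Set.mem_singleton_iff.1 e).symm⟩,
      fun h => hcon x fun e => h.2 e⟩
  have h2 : B.neighborSet a ⊆ (Set.univ \ {a}) \ {b} := fun x hx =>
    ⟨⟨trivial, fun e => hx.ne (Set.mem_singleton_iff.1 e).symm⟩,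
      fun e => hnab ((Set.mem_singleton_iff.1 e) ▸ hx)⟩
  have h3 := Set.ncard_le_ncard h2
  have h4 := Set.ncard_sdiff_singleton_add_one (Set.mem_univ v)
  have h5 := Set.ncard_sdiff_singleton_add_one (Set.mem_univ a)
  have h6 := Set.ncard_sdiff_singleton_add_one (s := Set.univ \ {a}) (a := b)
    ⟨trivial, fun e => hab e.symm⟩
  rw [← h1, hdeg] at h4
  rw [hdeg] at h3
  omega

lemma one_lt_numComp_neighborSet {v z : V} (hz : z ≠ v) (hvz : ¬ B.Adj v z) :
    1 < numComp B (B.neighborSet v) := by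
  have hv : v ∈ (B.neighborSet v)ᶜ := fun h => B.irrefl h
  refine one_lt_numComp_of_not_reachable (u := ⟨v, hv⟩) (v := ⟨z, hvz⟩) ?_
  refine SimpleGraph.not_reachable_of_neighborSet_left_eq_empty
    (fun e => hz (congrArg Subtype.val e).symm) ?_
  exact Set.eq_empty_of_forall_notMem fun x hx => x.2 hx

/-- Each neighbourhood `N(v)` is a cutset of size `r` of the whiskered graph. Accessibility yields
a cutset `N(v) \ {t}`, which does not disconnect `B`, so the count of components forces
all its vertices to carry whiskers; and not all of `N(v)` can, since removing it disconnects `B`. -/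
lemma existsUnique_adj_unwhiskered {W : Set V} (hnc : B ≠ ⊤)
    (hdeg : ∀ v, (B.neighborSet v).ncard = r)
    (hc0 : numComp B ∅ = 1) (hc : ∀ S : Set V, S.ncard < r → numComp B S = 1)
    (hU : ∀ S, IsWhiskerCutset B W S → numComp B S + (S ∩ W).ncard = S.ncard + 1)
    (hacc : ∀ S, IsWhiskerCutset B W S → S.Nonempty → ∃ t ∈ S, IsWhiskerCutset B W (S \ {t}))
    (v : V) : ∃ y, B.neighborSet v \ W = {y} := by
  obtain ⟨z, hz, hvz⟩ := exists_not_adj_of_ne_top hnc hdeg v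
  have h2 := one_lt_numComp_neighborSet hz hvz
  have hne : (B.neighborSet v).Nonempty := by
    by_contra h
    rw [Set.not_nonempty_iff_eq_empty.1 h, hc0] at h2
    exact h2.false
  have hr : 0 < r := hdeg v ▸ (Set.ncard_pos).2 hne
  have hsub : ∀ t ∈ B.neighborSet v, (B.neighborSet v \ {t}).ncard + 1 = r := fun t ht => by
    rw [Set.ncard_sdiff_singleton_add_one ht, hdeg]
  have hcut : IsWhiskerCutset B W (B.neighborSet v) :=
    isWhiskerCutset_of_forall fun t ht => Or.inr (by
      rw [hc _ (by have := hsub t ht; omega)]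
      exact h2)
  obtain ⟨t, ht, hcut'⟩ := hacc _ hcut hne
  have h3 := hU _ hcut
  have h4 := hU _ hcut'
  have h5 := hsub t ht
  rw [hc _ (by omega)] at h4
  have h6 : ((B.neighborSet v \ {t}) ∩ W).ncard ≤ (B.neighborSet v ∩ W).ncard :=
    Set.ncard_le_ncard (Set.inter_subset_inter_left _ Set.sdiff_subset)
  have h7 := Set.ncard_inter_add_ncard_sdiff_eq_ncard (B.neighborSet v) W
  rw [hdeg] at h3 h7
  exact Set.ncard_eq_one.1 (by omega)

/-- The set `W` of whiskered vertices is a cutset, so its removal leaves a connected graph;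
as that graph is also `1`-regular, it is a single edge. -/
lemma exists_unwhiskered_edge {W : Set V} [Nonempty V] {m : V → V}
    (hm : ∀ v, B.neighborSet v \ W = {m v})
    (hU : ∀ S, IsWhiskerCutset B W S → numComp B S + (S ∩ W).ncard = S.ncard + 1) :
    ∃ u u', u ∉ W ∧ u' ∉ W ∧ B.Adj u u' ∧ ∀ x, x ∉ W → x = u ∨ x = u' := by
  have hm1 : ∀ v, B.Adj v (m v) ∧ m v ∉ W := fun v => (hm v).ge rfl
  have hm2 : ∀ v x, B.Adj v x → x ∉ W → x = m v := fun v x h1 h2 => (hm v).le ⟨h1, h2⟩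
  have hcut : IsWhiskerCutset B W W := isWhiskerCutset_of_forall fun s hs =>
    Or.inl ⟨hs, numComp_diff_singleton_le (hm1 s).2 (hm1 s).1⟩
  have h1 := hU W hcut
  rw [Set.inter_self] at h1
  have h2 : numComp B W = 1 := by omega
  let u := m (Classical.arbitrary V)
  have hu : u ∉ W := (hm1 _).2
  refine ⟨u, m u, hu, (hm1 u).2, (hm1 u).1, fun x hx => ?_⟩
  have h3 : ∀ a b : V, a ∉ W → b ∉ W → B.Adj a b → (a = u ∨ a = m u) → (b = u ∨ b = m u) := by
    rintro a b - hb hab (rfl | rfl)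
    · exact Or.inr (hm2 _ _ hab hb)
    · exact Or.inl ((hm2 _ _ hab hb).trans (hm2 _ _ (hm1 u).1.symm hu).symm)
  have h4 := eq_of_reachable_of_forall_adj (G := B.induce Wᶜ)
    (f := fun a => a.1 = u ∨ a.1 = m u)
    (fun a b h => propext ⟨h3 a b a.2 b.2 h, h3 b a b.2 a.2 (SimpleGraph.Adj.symm h)⟩)
    (reachable_of_numComp_eq_one h2 ⟨u, hu⟩ ⟨x, hx⟩)
  exact h4.mp (Or.inl rfl)

/-- The combinatorial core: `B` is a star product whose only unwhiskered vertices are the ends of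
one matching edge. -/
lemma exists_iso_starProduct_of_whiskerCutsets {W : Set V} [Nonempty V] (hnc : B ≠ ⊤)
    (hdeg : ∀ v, (B.neighborSet v).ncard = r)
    (hc0 : numComp B ∅ = 1) (hc : ∀ S : Set V, S.ncard < r → numComp B S = 1)
    (hU : ∀ S, IsWhiskerCutset B W S → numComp B S + (S ∩ W).ncard = S.ncard + 1)
    (hacc : ∀ S, IsWhiskerCutset B W S → S.Nonempty → ∃ t ∈ S, IsWhiskerCutset B W (S \ {t})) :
    2 ≤ r ∧ ∃ e : B ≃g starProduct r, ∀ v, v ∈ W ↔ e v ∈ starWhiskerSet r := by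
  choose m hm using existsUnique_adj_unwhiskered hnc hdeg hc0 hc hU hacc
  have hm1 : ∀ v, B.Adj v (m v) ∧ m v ∉ W := fun v => (hm v).ge rfl
  have hm2 : ∀ v x, B.Adj v x → x ∉ W → x = m v := fun v x h1 h2 => (hm v).le ⟨h1, h2⟩
  obtain ⟨u, u', hu, hu', huu', hW⟩ := exists_unwhiskered_edge hm hU
  have hor : ∀ v, B.Adj v u ∨ B.Adj v u' := fun v => by
    have h1 := (hm1 v).1
    rcases hW _ (hm1 v).2 with h | h <;> rw [h] at h1
    exacts [Or.inl h1, Or.inr h1]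
  have hnot : ∀ v, B.Adj v u → ¬ B.Adj v u' := fun v h1 h2 =>
    huu'.ne ((hm2 v u h1 hu).trans (hm2 v u' h2 hu').symm)
  have hr : 2 ≤ r := by
    obtain ⟨z, hz, huz⟩ := exists_not_adj_of_ne_top hnc hdeg u
    have hz' : B.Adj z u' := (hor z).resolve_left fun h => huz h.symm
    rw [← hdeg u', ← Set.ncard_pair hz.symm]
    refine Set.ncard_le_ncard ?_
    rintro x (rfl | rfl)
    exacts [huu'.symm, hz'.symm]
  -- the two halves: `u` with its whiskered neighbours, and `u'` with its whiskered neighbours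
  let half : V → V → Set V := fun a b => insert a (B.neighborSet a \ {b})
  have hclique : ∀ a b, a ∉ W → B.Adj a b → (∀ x, x ∉ W → x = a ∨ x = b) →
      (∀ v, B.Adj v a ∨ B.Adj v b) → (∀ v, B.Adj v a → ¬ B.Adj v b) →
      B.IsClique (half a b) ∧ (half a b).ncard = r := by
    intro a b ha hab hWab hor' hnot'
    constructor
    · rintro x (rfl | ⟨hx, hxb⟩) y (rfl | ⟨hy, hyb⟩) hxy
      · exact (hxy rfl).elim
      · exact hy
      · exact hx.symm
      · exact adj_of_adj_unwhiskered hU ha hab hWab hor' hnot' hxy hxb hyb hx hy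
    · rw [Set.ncard_insert_of_notMem fun h => B.irrefl h.1,
        Set.ncard_sdiff_singleton_add_one (show b ∈ B.neighborSet a from hab), hdeg]
  have hcompl : ∀ v, v ∈ half u u' ↔ v ∉ half u' u := by
    intro v
    constructor
    · rintro (rfl | ⟨h1, h2⟩) (h3 | ⟨h3, h4⟩)
      · exact huu'.ne h3
      · exact h4 rfl
      · exact h2 h3
      · exact hnot v h1.symm h3.symm
    · intro h
      by_cases hvu : v = u
      · exact Or.inl hvu
      · have hvu' : v ≠ u' := fun e => h (Or.inl e)
        exact Or.inr ⟨((hor v).resolve_right fun h' => h (Or.inr ⟨h'.symm, hvu⟩)).symm, hvu'⟩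
  obtain ⟨hX, hXc⟩ := hclique u u' hu huu' hW hor hnot
  obtain ⟨hY, hYc⟩ := hclique u' u hu' huu'.symm (fun x hx => (hW x hx).symm)
    (fun v => (hor v).symm) (fun v h1 h2 => hnot v h2 h1)
  have hcompl' : ∀ v, v ∉ half u u' ↔ v ∈ half u' u := fun v => by rw [hcompl v, not_not]
  obtain ⟨k, rfl⟩ : ∃ k, r = k + 1 := ⟨r - 1, by omega⟩
  obtain ⟨e, he, he'⟩ := exists_iso_starProduct hcompl hX hY hXc
    (fun x hx => by
      simpa only [hcompl'] using existsUnique_adj_notMem_of_isClique hdeg hX hXc hx)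
    (fun y hy => by
      simpa only [← hcompl] using existsUnique_adj_notMem_of_isClique hdeg hY hYc hy)
    (Or.inl rfl) (Or.inl rfl) huu'
  refine ⟨hr, e, fun v => ?_⟩
  have h1 : e v ∈ starWhiskerSet (k + 1) ↔ ¬ (e v = Sum.inl 0 ∨ e v = Sum.inr 0) := by
    rcases e v with i | i <;> simp [starWhiskerSet]
  rw [h1, ← he, ← he', e.injective.eq_iff, e.injective.eq_iff]
  refine ⟨?_, fun h => by_contra fun hv => h (hW v hv)⟩
  rintro hv (rfl | rfl)
  exacts [hu hv, hu' hv]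

/-- Two whiskers at `v` would leave, with the rest of `B`, at least three components after removing
the cutset `{v}`. -/
lemma injective_of_isUnmixed {K : Type*} [Field K] {ι : Type*} [Finite ι] {p : ι → V}
    (hnc : B ≠ ⊤) (hc0 : numComp B ∅ = 1)
    (hU : IsUnmixed (binomialEdgeIdeal K (attachWhiskers B p))) : Function.Injective p := by
  intro i j hij
  by_contra hne
  have h0 : numComp (attachWhiskers B p) ∅ = 1 := by
    have := numComp_attachWhiskers B p ∅
    simpa [hc0] using this
  have h1 := numComp_attachWhiskers B p {p i}
  have hle : 2 ≤ Nat.card {k // p k ∈ ({p i} : Set V)} :=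
    Finite.one_lt_card_iff_nontrivial.2
      ⟨⟨i, rfl⟩, ⟨j, hij.symm⟩, fun e => hne (congrArg Subtype.val e)⟩
  rw [Set.image_singleton] at h1
  have h2 := numComp_eq_of_isUnmixed hU (T := {Sum.inl (p i)}) (by
    rintro _ rfl
    rw [sdiff_self, Set.bot_eq_empty, h0]
    omega)
  rw [Set.ncard_singleton, h0] at h2
  obtain ⟨z, hz⟩ : ∃ z, z ≠ p i := by
    by_contra! h
    exact hnc (eq_top_iff.2 fun a b hab => (hab ((h a).trans (h b).symm)).elim)
  have h3 : 0 < numComp B {p i} :=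
    have : Nonempty (B.induce ({p i} : Set V)ᶜ).ConnectedComponent :=
      ⟨SimpleGraph.connectedComponentMk _ ⟨z, hz⟩⟩
    Nat.card_pos
  omega

end Core

end BinomialEdge
open BinomialEdge in
theorem mainTheorem7 {K : Type*} [Field K] {V : Type*} [Fintype V] {ι : Type*} [Finite ι]
    (B : SimpleGraph V) [DecidableRel B.Adj] (r : ℕ) (p : ι → V)
    (hblock : IsBlock B) (hnc : B ≠ ⊤) (hreg : B.IsRegularOfDegree r)
    (hconn : IsRConnected r B) (hacc : IsAccessible K (attachWhiskers B p)) :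
    2 ≤ r ∧ Nonempty (attachWhiskers B p ≃g whiskeredStar r) := by
  have := hconn.1.nonempty
  have hdeg : ∀ v, (B.neighborSet v).ncard = r := fun v => by
    rw [← hreg v, ← SimpleGraph.coe_neighborFinset, Set.ncard_coe_finset,
      SimpleGraph.card_neighborFinset_eq_degree]
  have hc0 : numComp B ∅ = 1 := numComp_eq_one_of_connected (by
    rw [Set.compl_empty]
    exact B.induceUnivIso.connected_iff.2 hconn.1)
  have hp : Function.Injective p := injective_of_isUnmixed hnc hc0 hacc.1
  have hc0' : numComp (attachWhiskers B p) ∅ = 1 := by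
    simpa [hc0] using numComp_attachWhiskers B p ∅
  obtain ⟨hr, e, he⟩ := exists_iso_starProduct_of_whiskerCutsets (W := Set.range p) hnc hdeg hc0
    (fun S hS => numComp_eq_one_of_connected (hconn.2 S S.toFinite hS))
    (fun S hS => by
      have h := numComp_eq_of_isUnmixed hacc.1 ((isCutset_image_inl_iff hp S).2 hS)
      rwa [numComp_attachWhiskers, card_whiskers_eq_ncard hp, hc0',
        Set.ncard_image_of_injective _ Sum.inl_injective] at h)
    (fun S hS hne => by
      obtain ⟨_, ⟨t, ht, rfl⟩, hT⟩ := hacc.2 _ ((isCutset_image_inl_iff hp S).2 hS) (hne.image _)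
      rw [← Set.image_singleton, ← Set.image_sdiff Sum.inl_injective,
        isCutset_image_inl_iff hp] at hT
      exact ⟨t, ht, hT⟩)
  refine ⟨hr, ⟨attachWhiskersIso e
    ((Equiv.ofInjective p hp).trans (e.toEquiv.subtypeEquiv he)) fun i => rfl⟩⟩
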